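/- Let $\mathcal H$ be a separable complex Hilbert space and let $A$ be a bounded, self-adjoint, injective and not invertible operator on $\mathcal H$; $A^{-1}$ denotes its inverse with domain $\mathrm{Ran}\,A$. Let $N\in\mathbb N\cup\{0,+\infty\}$; dimensions take values in this set. Definitions. If $V$ is an isometry on $\mathcal H$, then $A$ is $V$-Hankel if $V^*A=AV$. An isometry is pure if it is unitarily equivalent to a direct sum of copies of the unilateral shift on $H^2$; its multiplicity is the dimension of the orthogonal complement of its range, i.e. the number of copies. $V$ has pure part of multiplicity $N$ if $V=V_0\oplus U$ (Wold decomposition) with $V_0$ pure of multiplicity $N$ and $U$ unitary. A closed, densely defined symmetric operator $T$ has deficiency indices $(N,N)$ if $\dim \mathrm{Ran}(T\pm iI)^\perp=N$ for both signs. $T$ is simple if there is no non-zero closed subspace $\mathcal J$ and no self-adjoint operator, densely defined in $\mathcal J$ with values in $\mathcal J$, which is a restriction of $T$. We write $B>0$ for a bounded operator $B$ that is positive semi-definite and injective. (1) For every linear subspace $M$ of $\mathcal H$: there is an isometry $V$ on $\mathcal H$ with pure part of multiplicity $N$ such that $A$ is $V$-Hankel and $\mathrm{Ran}\,V=M$ if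 and only if there is a closed, densely defined symmetric restriction $A_0$ of $A^{-1}$ with deficiency indices $(N,N)$ and $\mathrm{Ran}\,A_0=M$. In particular, $A$ is Hankel with respect to an isometry with pure part of multiplicity $N$ if and only if $A^{-1}$ has a closed, densely defined symmetric restriction with deficiency indices $(N,N)$. (2) If $V$ is an isometry with pure part of multiplicity $N$ and $A$ is $V$-Hankel, then $A_0:=A^{-1}|_{\mathrm{Ran}\,AV}$ is a closed, densely defined symmetric restriction of $A^{-1}$ with deficiency indices $(N,N)$, and $\mathrm{Ran}\,A_0=\mathrm{Ran}\,V$. If moreover $V$ is pure and $AV>0$, then $A_0$ is simple. (3) If $A_0$ is a closed, densely defined symmetric restriction of $A^{-1}$ with deficiency indices $(N,N)$, then $A_0$ has a polar decomposition $A_0=V|A_0|$, where $|A_0|=\sqrt{A_0^*A_0}$ and $V$ is a partial isometry with kernel $\mathrm{Ker}\,A_0$, and in any such decomposition $V$ is an isometry with pure part of multiplicity $N$ and $\mathrm{Ran}\,V=\mathrm{Ran}\,A_0$, and $A$ is $V$-Hankel. If moreover $A_0$ is simple and $N>0$, then this $V$ is pure; conversely, if this $V$ is pure and $AV>0$, then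 $A_0$ is simple. -/

import Mathlib

open scoped LinearPMap

namespace HankelSym

universe u

section Dimension

variable {E : Type u} [NormedAddCommGroup E] [InnerProductSpace ℂ E]

/-- The dimension of a subspace, with all infinite dimensions identified to `⊤`. -/
noncomputable def dim (K : Submodule ℂ E) : ℕ∞ :=
  Cardinal.toENat (Module.rank ℂ K)

end Dimension

section Isometries

variable {E : Type u} [NormedAddCommGroup E] [InnerProductSpace ℂ E]

/-- `V` is unitarily equivalent to a direct sum of copies, indexed by some `ι`, of the unilateral
shift. The vector-valued Hardy space `H² ⊗ ℂⁿ` is written through its Taylor coefficients, as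
`ℓ²(ℕ × ι)` with `n = #ι`; multiplication by the variable is then the right shift in the
`ℕ`-coordinate. -/
def IsPure (V : E →L[ℂ] E) : Prop :=
  ∃ (ι : Type u) (W : E ≃ₗᵢ[ℂ] lp (fun _ : ℕ × ι => ℂ) 2),
    ∀ (x : E) (i : ι), W (V x) (0, i) = 0 ∧ ∀ k : ℕ, W (V x) (k + 1, i) = W x (k, i)

/-- The multiplicity of a pure isometry: the dimension of the orthogonal complement of its
range. -/
noncomputable def shiftMult (V : E →L[ℂ] E) : ℕ∞ :=
  dim (LinearMap.range (V : E →ₗ[ℂ] E))ᗮ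

/-- The isometry `V` has a Wold decomposition `V = V₀ ⊕ U` on `H₀ ⊕ H₀ᗮ` with `U` unitary on `H₀ᗮ`
and with `V₀` a pure isometry on `H₀` of multiplicity `N`. -/
def HasPurePart (V : E →L[ℂ] E) (N : ℕ∞) : Prop :=
  ∃ (H₀ : Submodule ℂ E) (V₀ : H₀ →L[ℂ] H₀),
    IsClosed (H₀ : Set E) ∧ (∀ x : H₀, (V₀ x : E) = V x) ∧
    IsPure V₀ ∧ shiftMult V₀ = N ∧
    Submodule.map (V : E →ₗ[ℂ] E) H₀ᗮ = H₀ᗮ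

end Isometries

section Operators

variable {H : Type u} [NormedAddCommGroup H] [InnerProductSpace ℂ H] [CompleteSpace H]

/-- `A` is Hankel with respect to `V`: `V* A = A V`. -/
def IsHankel (A V : H →L[ℂ] H) : Prop :=
  (ContinuousLinearMap.adjoint V) ∘L A = A ∘L V

/-- `B > 0`: positive semi-definite and injective. -/
def IsStrictlyPos (B : H →L[ℂ] H) : Prop :=
  B.IsPositive ∧ Function.Injective B

/-- The inverse `A⁻¹` of an injective bounded operator, with domain `Ran A`. -/
noncomputable def inv (A : H →L[ℂ] H) : H →ₗ.[ℂ] H :=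
  ((A : H →ₗ[ℂ] H).toPMap ⊤).inverse

/-- The range of a partially defined operator. -/
def ran (T : H →ₗ.[ℂ] H) : Submodule ℂ H :=
  LinearMap.range T.toFun

/-- The kernel of a partially defined operator, as a subspace of the whole space. -/
def ker (T : H →ₗ.[ℂ] H) : Submodule ℂ H :=
  (LinearMap.ker T.toFun).map T.domain.subtype

/-- `Ran (T + z I)`. -/
def ranAdd (T : H →ₗ.[ℂ] H) (z : ℂ) : Submodule ℂ H :=
  LinearMap.range (T.toFun + z • T.domain.subtype)

/-- The deficiency indices `dim Ran (T ± iI)ᗮ` of `T` are `(m, n)`. -/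
def HasDeficiencyIndices (T : H →ₗ.[ℂ] H) (m n : ℕ∞) : Prop :=
  dim (ranAdd T Complex.I)ᗮ = m ∧ dim (ranAdd T (-Complex.I))ᗮ = n

/-- `T` is a closed, densely defined, symmetric restriction of `A⁻¹` with deficiency indices
`(N, N)`. -/
structure IsSymmRestriction (A : H →L[ℂ] H) (N : ℕ∞) (T : H →ₗ.[ℂ] H) : Prop where
  le_inv : T ≤ inv A
  dense : Dense (T.domain : Set H)
  closed : T.IsClosed
  symm : T.IsFormalAdjoint T
  deficiency : HasDeficiencyIndices T N N

/-- `T` is simple: there is no non-zero closed subspace `J` and no self-adjoint operator `D`,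
densely defined in `J` and with values in `J`, that is a restriction of `T`. -/
def IsSimple (T : H →ₗ.[ℂ] H) : Prop :=
  ∀ (J : Submodule ℂ H) [CompleteSpace J], J ≠ ⊥ →
    ∀ D : J →ₗ.[ℂ] J, Dense (D.domain : Set J) → IsSelfAdjoint D →
      ¬ ∀ x : D.domain, (((x : J) : H), ((D x : J) : H)) ∈ T.graph

/-- `S = |T|`: `S` is self-adjoint, positive semi-definite and `S² = T* T`, where the products have
their natural domains. -/
structure IsAbs (T S : H →ₗ.[ℂ] H) : Prop where
  selfAdjoint : IsSelfAdjoint S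
  nonneg : ∀ x : S.domain, 0 ≤ (inner ℂ (S x) (x : H)).re
  sq : ∀ x y : H, (∃ z, (x, z) ∈ S.graph ∧ (z, y) ∈ S.graph) ↔
    (∃ z, (x, z) ∈ T.graph ∧ (z, y) ∈ T†.graph)

/-- `T = V |T|` is the polar decomposition of `T`: `V` is the partial isometry with kernel `Ker T`
and initial space `(Ker T)ᗮ`. -/
structure IsPolarDecomposition (T : H →ₗ.[ℂ] H) (V : H →L[ℂ] H) (S : H →ₗ.[ℂ] H) : Prop where
  abs : IsAbs T S
  eq_comp : T = (V : H →ₗ[ℂ] H).compPMap S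
  norm_eq : ∀ x ∈ (ker T)ᗮ, ‖V x‖ = ‖x‖
  eq_zero : ∀ x ∈ ker T, V x = 0

end Operators

end HankelSym

/-!
Since `A` is injective, a restriction `T` of `A⁻¹` is determined by its range `M`: its graph is
`{(A y, y) : y ∈ M}` (`mem_graph_of_le_inv`). Such a `T` is automatically symmetric, it is closed
if and only if `M` is closed, and since `Ran (T + z) = (1 + z A) M` with `1 + z A` invertible for
non-real `z`, both deficiency indices equal `dim Mᗮ` (`dim_ranAdd_orthogonal`). On the other side,
the Wold decomposition shows that an isometry `V` has pure part of multiplicity `N` if and only if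
`dim (Ran V)ᗮ = N` (`HasPurePart.dim_eq`, `hasPurePart_of_isometry`), and `A` is `V`-Hankel if and
only if `A V` is self-adjoint. If so, `Ran A V` is dense, and `A⁻¹` restricted to `Ran A V` has
range `Ran V`; this gives the passage from isometries to restrictions.

For the converse, let `P` be the projection to `M = Ran T`. Then `T* T = (A P A)⁻¹`, so that
`|T| = B⁻¹` with `B = √(A P A)`. The isometry `V` with `V B = P A` satisfies `A V = B` and
`Ran V = M` (`exists_isPolarDecomposition`). In an arbitrary polar decomposition `T = V S`, the
positive self-adjoint operator `S` is a bijection onto the space with inverse `A V`, whence `A V`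
is self-adjoint and positive (`IsPolarDecomposition.isHankel`).

Simplicity is compared with purity under `A V ≥ 0`.
* If `T` has a self-adjoint part in `J`, then `J ⊆ Ran V` and `A J ⊆ J`, so that `(A V)² = A²` on
  `J`. Hence `J` reduces `(A V)²`, its square root `A V`, and finally `V*`. Repeated application of
  `V*` inside `Ran V` shows `J ⊆ ⋂ₙ Ran Vⁿ`, which is zero for a pure `V` (`isSimple_of_isPure`).
* On the unitary part `⋂ₙ Ran Vⁿ`, positivity of `A V` forces `V² = 1`
  (`map_map_eq_of_mem_unitaryPart`). Consequently `A` leaves this part invariant, and the inverse of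
  the restriction of `A` to it is a self-adjoint part of `T` (`isPure_of_isSimple`).
-/

namespace HankelSym

universe u

section

variable {H : Type u} [NormedAddCommGroup H] [InnerProductSpace ℂ H]

local notation "⟪" x "," y "⟫" => inner ℂ x y

/-! ### Restrictions of the inverse of a bounded operator -/

theorem mem_graph_inv {A : H →L[ℂ] H} (hinj : Function.Injective A) {x y : H} :
    (x, y) ∈ (inv A).graph ↔ A y = x := by
  have hker : LinearMap.ker ((A : H →ₗ[ℂ] H).toPMap ⊤).toFun = ⊥ := by
    rw [LinearMap.ker_eq_bot]
    intro a b hab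
    exact Subtype.ext (hinj hab)
  rw [inv, LinearPMap.inverse_graph hker]
  simp only [Submodule.mem_map, Prod.exists, LinearEquiv.coe_coe, LinearEquiv.prodComm_apply,
    Prod.swap_prod_mk, Prod.mk.injEq]
  constructor
  · rintro ⟨a, b, hab, rfl, rfl⟩
    obtain ⟨z, hz, hz'⟩ := (LinearPMap.mem_graph_iff _).1 hab
    simp only at hz hz'
    rw [← hz, ← hz']
    rfl
  · rintro rfl
    exact ⟨y, A y, (LinearPMap.mem_graph_iff _).2 ⟨⟨y, trivial⟩, rfl, rfl⟩, rfl, rfl⟩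

theorem mem_ran {T : H →ₗ.[ℂ] H} {y : H} : y ∈ ran T ↔ ∃ x, (x, y) ∈ T.graph := by
  rw [ran, LinearMap.mem_range]
  constructor
  · rintro ⟨x, rfl⟩
    exact ⟨x, T.mem_graph x⟩
  · rintro ⟨x, hx⟩
    obtain ⟨z, -, hz⟩ := (LinearPMap.mem_graph_iff _).1 hx
    exact ⟨z, hz⟩

/-- A restriction of `A⁻¹` is determined by its range: its graph is the flipped graph of `A` on
that range. -/
theorem mem_graph_of_le_inv {A : H →L[ℂ] H} (hinj : Function.Injective A) {T : H →ₗ.[ℂ] H}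
    (hT : T ≤ inv A) {x y : H} : (x, y) ∈ T.graph ↔ y ∈ ran T ∧ A y = x := by
  have hle := LinearPMap.le_graph_of_le hT
  constructor
  · intro h
    exact ⟨mem_ran.2 ⟨x, h⟩, (mem_graph_inv hinj).1 (hle h)⟩
  · rintro ⟨h, rfl⟩
    obtain ⟨x, hx⟩ := mem_ran.1 h
    rwa [(mem_graph_inv hinj).1 (hle hx)]

theorem mem_domain_of_le_inv {A : H →L[ℂ] H} (hinj : Function.Injective A) {T : H →ₗ.[ℂ] H}
    (hT : T ≤ inv A) {x : H} : x ∈ T.domain ↔ ∃ y ∈ ran T, A y = x := by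
  simp [LinearPMap.mem_domain_iff, mem_graph_of_le_inv hinj hT]

theorem ker_eq_bot_of_le_inv {A : H →L[ℂ] H} (hinj : Function.Injective A) {T : H →ₗ.[ℂ] H}
    (hT : T ≤ inv A) : ker T = ⊥ := by
  rw [Submodule.eq_bot_iff]
  rintro _ ⟨x, hx, rfl⟩
  have h := ((mem_graph_of_le_inv hinj hT).1 (T.mem_graph x)).2
  rw [show T x = 0 from hx, map_zero] at h
  exact h.symm

theorem isClosed_iff_of_le_inv {A : H →L[ℂ] H} (hinj : Function.Injective A) {T : H →ₗ.[ℂ] H}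
    (hT : T ≤ inv A) : T.IsClosed ↔ IsClosed (ran T : Set H) := by
  constructor
  · intro h
    have h1 : (ran T : Set H) = (fun y : H => (A y, y)) ⁻¹' (T.graph : Set (H × H)) := by
      ext y
      simp [mem_graph_of_le_inv hinj hT]
    rw [h1]
    exact h.preimage (by fun_prop)
  · intro h
    have h1 : (T.graph : Set (H × H)) = (Prod.snd ⁻¹' (ran T : Set H)) ∩ {p | A p.2 = p.1} := by
      ext ⟨x, y⟩
      simp [mem_graph_of_le_inv hinj hT]
    rw [LinearPMap.IsClosed, h1]
    exact (h.preimage continuous_snd).inter (isClosed_eq (by fun_prop) (by fun_prop))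

theorem isFormalAdjoint_of_le_inv [CompleteSpace H] {A : H →L[ℂ] H} (hA : IsSelfAdjoint A)
    (hinj : Function.Injective A) {T : H →ₗ.[ℂ] H} (hT : T ≤ inv A) : T.IsFormalAdjoint T := by
  intro x y
  have hx := ((mem_graph_of_le_inv hinj hT).1 (T.mem_graph x)).2
  have hy := ((mem_graph_of_le_inv hinj hT).1 (T.mem_graph y)).2
  rw [← hx, ← hy]
  exact (hA.isSymmetric _ _).symm

theorem compPMap_mem_graph {V : H →L[ℂ] H} {S : H →ₗ.[ℂ] H} {x y : H} :
    (x, y) ∈ ((V : H →ₗ[ℂ] H).compPMap S).graph ↔ ∃ z, (x, z) ∈ S.graph ∧ V z = y := by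
  simp only [LinearPMap.mem_graph_iff]
  constructor
  · rintro ⟨w, hw, rfl⟩
    exact ⟨S w, ⟨w, hw, rfl⟩, rfl⟩
  · rintro ⟨z, ⟨w, hw, rfl⟩, rfl⟩
    exact ⟨w, hw, rfl⟩

theorem ran_domRestrict_inv {A V : H →L[ℂ] H} (hinj : Function.Injective A) :
    ran ((inv A).domRestrict (LinearMap.range ((A ∘L V : H →L[ℂ] H) : H →ₗ[ℂ] H))) =
      LinearMap.range (V : H →ₗ[ℂ] H) := by
  set T := (inv A).domRestrict (LinearMap.range ((A ∘L V : H →L[ℂ] H) : H →ₗ[ℂ] H))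
  have hT : T ≤ inv A := LinearPMap.domRestrict_le
  ext y
  constructor
  · intro hy
    obtain ⟨x, hx⟩ := mem_ran.1 hy
    have h1 := ((mem_graph_of_le_inv hinj hT).1 hx).2
    have h2 : x ∈ T.domain := LinearPMap.mem_domain_of_mem_graph hx
    obtain ⟨⟨w, hw⟩, -⟩ := h2
    have : A (V w) = A y := by rw [h1]; exact hw
    exact ⟨w, hinj this⟩
  · rintro ⟨w, rfl⟩
    have h1 : A (V w) ∈ (inv A).domain :=
      LinearPMap.mem_domain_of_mem_graph ((mem_graph_inv hinj (y := V w)).2 rfl)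
    have h2 : A (V w) ∈ T.domain := ⟨⟨w, rfl⟩, h1⟩
    obtain ⟨y, hy⟩ := LinearPMap.mem_domain_iff.1 h2
    obtain ⟨h3, h4⟩ := (mem_graph_of_le_inv hinj hT).1 hy
    have : y = V w := hinj h4
    rwa [this] at h3

theorem dim_eq_of_linearEquiv {E F : Type u} [NormedAddCommGroup E] [InnerProductSpace ℂ E]
    [NormedAddCommGroup F] [InnerProductSpace ℂ F] {K : Submodule ℂ E} {L : Submodule ℂ F}
    (e : K ≃ₗ[ℂ] L) : dim K = dim L := by
  rw [dim, dim, e.rank_eq]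

theorem isUnit_one_add_smul [CompleteSpace H] {A : H →L[ℂ] H} (hA : IsSelfAdjoint A) {z : ℂ}
    (hz : z.im ≠ 0) : IsUnit (1 + z • A) := by
  have hz0 : z ≠ 0 := fun h => hz (by simp [h])
  have h1 : -z⁻¹ ∉ spectrum ℂ A := by
    intro h
    have h2 := hA.im_eq_zero_of_mem_spectrum h
    rw [Complex.neg_im, Complex.inv_im] at h2
    have h3 : Complex.normSq z ≠ 0 := by simpa using hz0
    field_simp at h2
    simp at h2
    exact hz h2
  rw [spectrum.notMem_iff] at h1
  have h3 : (1 + z • A) = (Units.mk0 (-z) (neg_ne_zero.2 hz0)) •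
      (algebraMap ℂ (H →L[ℂ] H) (-z⁻¹) - A) := by
    rw [Units.smul_def, Units.val_mk0, smul_sub, Algebra.algebraMap_eq_smul_one, smul_smul]
    simp [hz0]
  rw [h3]
  exact (isUnit_smul_iff _ _).2 h1

/-- For a restriction `T` of `A⁻¹`, `Ran (T + z)` is the image of `Ran T` under `1 + z A`, which is
invertible for non-real `z`. -/
theorem dim_ranAdd_orthogonal [CompleteSpace H] {A : H →L[ℂ] H} (hA : IsSelfAdjoint A)
    (hinj : Function.Injective A) {T : H →ₗ.[ℂ] H} (hT : T ≤ inv A) {z : ℂ} (hz : z.im ≠ 0) :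
    dim (ranAdd T z)ᗮ = dim (ran T)ᗮ := by
  have hadj : ContinuousLinearMap.adjoint (1 + z • A) = 1 + (starRingEnd ℂ z) • A := by
    rw [← ContinuousLinearMap.star_eq_adjoint, star_add, star_smul, hA.star_eq, star_one]
    rfl
  have hu : IsUnit (ContinuousLinearMap.adjoint (1 + z • A)) := by
    rw [hadj]
    exact isUnit_one_add_smul hA (by simpa using hz)
  let e : H ≃L[ℂ] H := ContinuousLinearEquiv.unitsEquiv ℂ H hu.unit
  have he : ∀ x, e x = ContinuousLinearMap.adjoint (1 + z • A) x := fun x => rfl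
  have h1 : (ranAdd T z)ᗮ = ((ran T)ᗮ).comap (e.toLinearEquiv : H →ₗ[ℂ] H) := by
    ext x
    rw [Submodule.mem_comap, Submodule.mem_orthogonal, Submodule.mem_orthogonal]
    have key : ∀ y, ⟪y, e x⟫ = ⟪y + z • A y, x⟫ := by
      intro y
      rw [he, ContinuousLinearMap.adjoint_inner_right]
      rfl
    constructor
    · intro h y hy
      obtain ⟨w, rfl⟩ := hy
      have hw := ((mem_graph_of_le_inv hinj hT).1 (T.mem_graph w)).2
      have := h (T.toFun w + z • (w : H)) ⟨w, rfl⟩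
      rw [← hw] at this
      rw [← this]
      exact key _
    · rintro h _ ⟨w, rfl⟩
      have hw := ((mem_graph_of_le_inv hinj hT).1 (T.mem_graph w)).2
      have := h (T w) ⟨w, rfl⟩
      rw [← this]
      refine Eq.trans ?_ (key _).symm
      rw [hw]
      rfl
  rw [h1]
  refine dim_eq_of_linearEquiv ((e.toLinearEquiv.submoduleMap _).trans
    (LinearEquiv.ofEq _ _ ?_))
  exact Submodule.map_comap_eq_of_surjective e.surjective _

theorem hasDeficiencyIndices_iff [CompleteSpace H] {A : H →L[ℂ] H} (hA : IsSelfAdjoint A)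
    (hinj : Function.Injective A) {T : H →ₗ.[ℂ] H} (hT : T ≤ inv A) {N : ℕ∞} :
    HasDeficiencyIndices T N N ↔ dim (ran T)ᗮ = N := by
  rw [HasDeficiencyIndices, dim_ranAdd_orthogonal hA hinj hT (by simp),
    dim_ranAdd_orthogonal hA hinj hT (by simp), and_self]

/-- A bounded self-adjoint injective operator has dense range. -/
theorem denseRange_of_isSelfAdjoint [CompleteSpace H] {C : H →L[ℂ] H} (hC : IsSelfAdjoint C)
    (hinj : Function.Injective C) : DenseRange C := by
  have h : (LinearMap.range (C : H →ₗ[ℂ] H)).topologicalClosure = ⊤ := by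
    rw [Submodule.topologicalClosure_eq_top_iff, Submodule.eq_bot_iff]
    intro x hx
    apply hinj
    rw [map_zero, ← inner_self_eq_zero (𝕜 := ℂ)]
    have := hC.isSymmetric (C x) x
    simp only [ContinuousLinearMap.coe_coe] at this
    rw [← this]
    exact hx _ ⟨_, rfl⟩
  exact Submodule.dense_iff_topologicalClosure_eq_top.2 h

theorem dense_domain_inv [CompleteSpace H] {C : H →L[ℂ] H} (hC : IsSelfAdjoint C)
    (hinj : Function.Injective C) : Dense ((inv C).domain : Set H) := by
  have h : ((inv C).domain : Set H) = Set.range C := by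
    ext x
    simp [LinearPMap.mem_domain_iff, mem_graph_inv hinj]
  rw [h]
  exact denseRange_of_isSelfAdjoint hC hinj

theorem mem_graph_adjoint [CompleteSpace H] {T : H →ₗ.[ℂ] H} (hT : Dense (T.domain : Set H))
    {x y : H} : (x, y) ∈ T†.graph ↔ ∀ a b, (a, b) ∈ T.graph → ⟪b, x⟫ = ⟪a, y⟫ := by
  rw [T.adjoint_graph_eq_graph_adjoint hT, Submodule.mem_adjoint_iff]
  simp only [sub_eq_zero]

theorem isSelfAdjoint_inv [CompleteSpace H] {C : H →L[ℂ] H} (hC : IsSelfAdjoint C)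
    (hinj : Function.Injective C) : IsSelfAdjoint (inv C) := by
  rw [LinearPMap.isSelfAdjoint_def]
  apply LinearPMap.eq_of_eq_graph
  ext ⟨x, y⟩
  rw [mem_graph_adjoint (dense_domain_inv hC hinj)]
  simp only [mem_graph_inv hinj]
  constructor
  · intro h
    refine ext_inner_left ℂ fun v => ?_
    rw [h _ v rfl]
    exact (hC.isSymmetric _ _).symm
  · rintro rfl a b rfl
    exact (hC.isSymmetric _ _).symm

/-! ### The Wold decomposition -/

theorem inner_map_map_of_isometry {V : H →L[ℂ] H} (hV : Isometry V) (x y : H) :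
    ⟪V x, V y⟫ = ⟪x, y⟫ :=
  (LinearMap.norm_map_iff_inner_map_map V).1
    ((AddMonoidHomClass.isometry_iff_norm V).1 hV) x y

theorem isometry_pow {V : H →L[ℂ] H} (hV : Isometry V) (n : ℕ) : Isometry (V ^ n) := by
  induction n with
  | zero => exact isometry_id
  | succ n ih =>
    rw [pow_succ]
    exact ih.comp hV

theorem isClosed_range_of_isometry [CompleteSpace H] {V : H →L[ℂ] H} (hV : Isometry V) :
    IsClosed (LinearMap.range (V : H →ₗ[ℂ] H) : Set H) := by
  have h : (LinearMap.range (V : H →ₗ[ℂ] H) : Set H) = Set.range V := by ext; simp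
  rw [h]
  exact hV.isClosedEmbedding.isClosed_range

theorem adjoint_apply_of_isometry [CompleteSpace H] {V : H →L[ℂ] H} (hV : Isometry V) (x : H) :
    ContinuousLinearMap.adjoint V (V x) = x :=
  DFunLike.congr_fun ((ContinuousLinearMap.isometry_iff_adjoint_comp_self V).1 hV) x

theorem range_orthogonal_orthogonal [CompleteSpace H] {V : H →L[ℂ] H} (hV : Isometry V) :
    (LinearMap.range (V : H →ₗ[ℂ] H))ᗮᗮ = LinearMap.range (V : H →ₗ[ℂ] H) := by
  rw [Submodule.orthogonal_orthogonal_eq_closure]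
  exact (isClosed_range_of_isometry hV).submodule_topologicalClosure_eq

/-- An isometry whose powers have ranges with trivial intersection is pure: for a Hilbert basis
`(eᵢ)` of `(Ran V)ᗮ`, the vectors `Vⁿ eᵢ` form a Hilbert basis of the whole space, and `V` acts as
the shift on the coordinates with respect to it. -/
theorem isPure_of_forall_mem_range_pow [CompleteSpace H] {V : H →L[ℂ] H} (hV : Isometry V)
    (h : ∀ x, (∀ n : ℕ, ∃ y, (V ^ n) y = x) → x = 0) : IsPure V := by
  classical
  set K : Submodule ℂ H := (LinearMap.range (V : H →ₗ[ℂ] H))ᗮ with hK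
  obtain ⟨ι, b, -⟩ := exists_hilbertBasis ℂ K
  have hKV : ∀ (k : K) (y : H), ⟪(k : H), V y⟫ = 0 := fun k y =>
    (Submodule.mem_orthogonal' _ _).1 k.2 _ ⟨y, rfl⟩
  let e : ℕ × ι → H := fun p => (V ^ p.1) (b p.2)
  have hin : ∀ (n m : ℕ) (i j : ι), n < m → ⟪(V ^ n) (b i : H), (V ^ m) (b j : H)⟫ = 0 := by
    intro n m i j hnm
    obtain ⟨k, rfl⟩ := Nat.exists_eq_add_of_lt hnm
    rw [add_assoc, pow_add, mul_apply_eq_comp,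
      inner_map_map_of_isometry (isometry_pow hV n), pow_succ', mul_apply_eq_comp, hKV]
  have he : Orthonormal ℂ e := by
    constructor
    · rintro ⟨n, i⟩
      simp only [e]
      rw [(AddMonoidHomClass.isometry_iff_norm (V ^ n)).1 (isometry_pow hV n)]
      exact b.orthonormal.1 i
    · rintro ⟨n, i⟩ ⟨m, j⟩ hne
      simp only [e]
      rcases lt_trichotomy n m with hlt | rfl | hlt
      · exact hin n m i j hlt
      · rw [inner_map_map_of_isometry (isometry_pow hV n)]
        exact b.orthonormal.2 (fun hij => hne (by rw [hij]))
      · rw [← inner_conj_symm, hin m n j i hlt, map_zero]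
  have hsp : (Submodule.span ℂ (Set.range e))ᗮ = ⊥ := by
    rw [Submodule.eq_bot_iff]
    intro x hx
    have hx' : ∀ p, ⟪e p, x⟫ = 0 := fun p =>
      (Submodule.mem_orthogonal _ _).1 hx _ (Submodule.subset_span ⟨p, rfl⟩)
    apply h
    intro n
    induction n with
    | zero => exact ⟨x, rfl⟩
    | succ n ih =>
      obtain ⟨y, rfl⟩ := ih
      have hy : y ∈ LinearMap.range (V : H →ₗ[ℂ] H) := by
        rw [← range_orthogonal_orthogonal hV, ← hK, Submodule.mem_orthogonal]
        intro u hu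
        have hb : ∀ i, b.repr (K.orthogonalProjectionOnto y) i = 0 := by
          intro i
          rw [b.repr_apply_apply]
          have := hx' (n, i)
          simp only [e] at this
          rw [inner_map_map_of_isometry (isometry_pow hV n)] at this
          rw [← this]
          simp
        have h0 : K.orthogonalProjectionOnto y = 0 := by
          apply b.repr.injective
          ext i
          rw [hb]
          simp
        have := (Submodule.orthogonalProjectionOnto_eq_zero_iff).1 h0
        exact (Submodule.mem_orthogonal _ _).1 this _ hu
      obtain ⟨z, rfl⟩ := hy
      exact ⟨z, by rw [pow_succ]; rfl⟩
  let B := HilbertBasis.mkOfOrthogonalEqBot he hsp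
  have hB : ∀ p, B p = e p := fun p => by
    rw [show ⇑B = e from HilbertBasis.coe_mkOfOrthogonalEqBot he hsp]
  refine ⟨ι, B.repr, fun x i => ⟨?_, fun k => ?_⟩⟩
  · rw [B.repr_apply_apply, hB]
    exact hKV _ _
  · rw [B.repr_apply_apply, B.repr_apply_apply, hB, hB]
    simp only [e]
    rw [pow_succ', mul_apply_eq_comp, inner_map_map_of_isometry hV]

/-- The subspace on which an isometry `V` acts as a unitary: `⋂ₙ Ran Vⁿ`. -/
def unitaryPart (V : H →L[ℂ] H) : Submodule ℂ H :=
  ⨅ n : ℕ, LinearMap.range ((V ^ n : H →L[ℂ] H) : H →ₗ[ℂ] H)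

theorem mem_unitaryPart {V : H →L[ℂ] H} {x : H} :
    x ∈ unitaryPart V ↔ ∀ n : ℕ, ∃ y, (V ^ n) y = x := by
  rw [unitaryPart, Submodule.mem_iInf]
  rfl

theorem isClosed_unitaryPart [CompleteSpace H] {V : H →L[ℂ] H} (hV : Isometry V) :
    IsClosed (unitaryPart V : Set H) := by
  rw [unitaryPart, Submodule.coe_iInf]
  exact isClosed_iInter fun n => isClosed_range_of_isometry (isometry_pow hV n)

theorem map_mem_unitaryPart {V : H →L[ℂ] H} {x : H} (hx : x ∈ unitaryPart V) :
    V x ∈ unitaryPart V := by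
  rw [mem_unitaryPart] at hx ⊢
  intro n
  obtain ⟨y, hy⟩ := hx n
  refine ⟨V y, ?_⟩
  rw [← hy, ← mul_apply_eq_comp, ← pow_succ, pow_succ']
  rfl

theorem exists_map_eq_of_mem_unitaryPart {V : H →L[ℂ] H} (hV : Isometry V) {x : H}
    (hx : x ∈ unitaryPart V) : ∃ y ∈ unitaryPart V, V y = x := by
  rw [mem_unitaryPart] at hx
  obtain ⟨y, hy⟩ := hx 1
  rw [pow_one] at hy
  refine ⟨y, mem_unitaryPart.2 fun n => ?_, hy⟩
  obtain ⟨z, hz⟩ := hx (n + 1)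
  refine ⟨z, hV.injective ?_⟩
  rw [hy, ← hz, pow_succ']
  rfl

theorem map_unitaryPart {V : H →L[ℂ] H} (hV : Isometry V) :
    Submodule.map (V : H →ₗ[ℂ] H) (unitaryPart V) = unitaryPart V := by
  ext x
  constructor
  · rintro ⟨y, hy, rfl⟩
    exact map_mem_unitaryPart hy
  · intro hx
    exact exists_map_eq_of_mem_unitaryPart hV hx

/-- The unitary summand of a decomposition `V = V₀ ⊕ U` does not contribute to `(Ran V)ᗮ`. -/
theorem shiftMult_eq [CompleteSpace H] {V : H →L[ℂ] H} {H₀ : Submodule ℂ H} {V₀ : H₀ →L[ℂ] H₀}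
    (hcl : IsClosed (H₀ : Set H)) (hV₀ : ∀ x : H₀, (V₀ x : H) = V x)
    (hmap : Submodule.map (V : H →ₗ[ℂ] H) H₀ᗮ = H₀ᗮ) :
    shiftMult V₀ = dim (LinearMap.range (V : H →ₗ[ℂ] H))ᗮ := by
  have : CompleteSpace H₀ := hcl.completeSpace_coe
  have h : ((LinearMap.range (V₀ : H₀ →ₗ[ℂ] H₀))ᗮ).map H₀.subtype =
      (LinearMap.range (V : H →ₗ[ℂ] H))ᗮ := by
    ext x
    constructor
    · rintro ⟨k, hk, rfl⟩
      rw [Submodule.mem_orthogonal]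
      rintro _ ⟨y, rfl⟩
      obtain ⟨a, ha, c, hc, rfl⟩ := Submodule.exists_add_mem_mem_orthogonal (K := H₀) y
      have h1 : ⟪V a, (k : H)⟫ = 0 := by
        have := (Submodule.mem_orthogonal _ _).1 hk (V₀ ⟨a, ha⟩) ⟨_, rfl⟩
        rw [← hV₀ ⟨a, ha⟩]
        exact this
      have h2 : ⟪V c, (k : H)⟫ = 0 := by
        have : V c ∈ H₀ᗮ := by
          rw [← hmap]
          exact ⟨c, hc, rfl⟩
        exact (Submodule.mem_orthogonal' _ _).1 this _ k.2
      simp [inner_add_left, h1, h2]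
    · intro hx
      have hx0 : x ∈ H₀ := by
        rw [← Submodule.orthogonal_orthogonal H₀, Submodule.mem_orthogonal]
        intro u hu
        rw [← hmap] at hu
        obtain ⟨w, -, rfl⟩ := hu
        exact (Submodule.mem_orthogonal _ _).1 hx _ ⟨w, rfl⟩
      refine ⟨⟨x, hx0⟩, ?_, rfl⟩
      refine (Submodule.mem_orthogonal _ _).2 ?_
      rintro _ ⟨y, rfl⟩
      rw [Submodule.coe_inner]
      refine (Submodule.mem_orthogonal _ _).1 hx _ ⟨y, ?_⟩
      exact (hV₀ y).symm
  rw [shiftMult, ← h]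
  exact dim_eq_of_linearEquiv (Submodule.equivMapOfInjective _ H₀.injective_subtype _)

theorem HasPurePart.dim_eq [CompleteSpace H] {V : H →L[ℂ] H} {N : ℕ∞} (h : HasPurePart V N) :
    dim (LinearMap.range (V : H →ₗ[ℂ] H))ᗮ = N := by
  obtain ⟨H₀, V₀, hcl, hV₀, -, rfl, hmap⟩ := h
  exact (shiftMult_eq hcl hV₀ hmap).symm

/-- The **Wold decomposition**: the pure part of an isometry lives on the orthogonal complement of
its unitary part. -/
theorem hasPurePart_of_isometry [CompleteSpace H] {V : H →L[ℂ] H} (hV : Isometry V) :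
    HasPurePart V (dim (LinearMap.range (V : H →ₗ[ℂ] H))ᗮ) := by
  have : CompleteSpace (unitaryPart V) := (isClosed_unitaryPart hV).completeSpace_coe
  have hinv : ∀ x ∈ (unitaryPart V)ᗮ, V x ∈ (unitaryPart V)ᗮ := by
    intro x hx
    rw [Submodule.mem_orthogonal]
    intro u hu
    obtain ⟨w, hw, rfl⟩ := exists_map_eq_of_mem_unitaryPart hV hu
    rw [inner_map_map_of_isometry hV]
    exact (Submodule.mem_orthogonal _ _).1 hx _ hw
  have hcl : IsClosed ((unitaryPart V)ᗮ : Set H) := Submodule.isClosed_orthogonal _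
  let V₀ : ((unitaryPart V)ᗮ : Submodule ℂ H) →L[ℂ] ((unitaryPart V)ᗮ : Submodule ℂ H) :=
    (V ∘L (unitaryPart V)ᗮ.subtypeL).codRestrict _ (fun x => hinv x x.2)
  have hV₀ : ∀ x, (V₀ x : H) = V x := fun x => rfl
  have hmap : Submodule.map (V : H →ₗ[ℂ] H) (unitaryPart V)ᗮᗮ = (unitaryPart V)ᗮᗮ := by
    rw [Submodule.orthogonal_orthogonal, map_unitaryPart hV]
  refine ⟨(unitaryPart V)ᗮ, V₀, hcl, hV₀, ?_, shiftMult_eq hcl hV₀ hmap, hmap⟩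
  have hiso : Isometry V₀ := by
    rw [AddMonoidHomClass.isometry_iff_norm]
    intro x
    exact (AddMonoidHomClass.isometry_iff_norm V).1 hV x
  refine isPure_of_forall_mem_range_pow hiso fun x hx => ?_
  have hpow : ∀ (n : ℕ) (y : ((unitaryPart V)ᗮ : Submodule ℂ H)),
      (((V₀ ^ n) y : ((unitaryPart V)ᗮ : Submodule ℂ H)) : H) = (V ^ n) (y : H) := by
    intro n
    induction n with
    | zero => intro y; rfl
    | succ n ih =>
      intro y
      rw [pow_succ, pow_succ, mul_apply_eq_comp, mul_apply_eq_comp, ih, hV₀]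
  have hxU : (x : H) ∈ unitaryPart V := by
    rw [mem_unitaryPart]
    intro n
    obtain ⟨y, rfl⟩ := hx n
    exact ⟨y, (hpow n y).symm⟩
  have := (Submodule.mem_orthogonal _ _).1 x.2 _ hxU
  exact Subtype.ext (inner_self_eq_zero.1 this)

/-- A pure isometry has no non-zero subset of its range that is invariant under `V*`. -/
theorem IsPure.eq_zero_of_mem {V : H →L[ℂ] H} (hV : IsPure V) {J : Set H}
    (hJ : ∀ x ∈ J, ∃ y ∈ J, V y = x) {x : H} (hx : x ∈ J) : x = 0 := by
  obtain ⟨ι, W, hW⟩ := hV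
  have h : ∀ (k : ℕ) (i : ι), ∀ x ∈ J, W x (k, i) = 0 := by
    intro k i
    induction k with
    | zero =>
      intro x hx
      obtain ⟨y, -, rfl⟩ := hJ x hx
      exact (hW y i).1
    | succ k ih =>
      intro x hx
      obtain ⟨y, hy, rfl⟩ := hJ x hx
      rw [(hW y i).2, ih y hy]
  apply W.injective
  ext ⟨k, i⟩
  rw [h k i x hx, map_zero]
  rfl

end

section

variable {H : Type u} [NormedAddCommGroup H] [InnerProductSpace ℂ H] [CompleteSpace H]

local notation "⟪" x "," y "⟫" => inner ℂ x y

/-! ### Commutation with positive operators -/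

theorem commute_starProjection {S : H →L[ℂ] H} (hS : IsSelfAdjoint S) {J : Submodule ℂ H}
    [J.HasOrthogonalProjection] (hJ : ∀ x ∈ J, S x ∈ J) : Commute J.starProjection S := by
  have h1 : J.starProjection * S * J.starProjection = S * J.starProjection := by
    ext x
    exact Submodule.starProjection_eq_self_iff.2 (hJ _ (Submodule.starProjection_apply_mem _ _))
  have h2 := congrArg star h1
  have hP : star J.starProjection = J.starProjection := isSelfAdjoint_starProjection J
  rw [star_mul, star_mul, star_mul, hP, hS.star_eq, ← mul_assoc] at h2
  exact h2.symm.trans h1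

/-- What commutes with the square of a positive operator commutes with the operator, which is the
square root of its square. -/
theorem commute_of_commute_mul_self {C W : H →L[ℂ] H} (hC : C.IsPositive)
    (h : Commute W (C * C)) : Commute W C := by
  have h0 : (0 : H →L[ℂ] H) ≤ C := (ContinuousLinearMap.nonneg_iff_isPositive C).2 hC
  have h1 : Commute (C * C) W := h.symm
  have h2 := h1.cfcₙ_nnreal NNReal.sqrt
  have h3 : CFC.sqrt (C * C) = C := CFC.sqrt_mul_self C h0
  rw [CFC.sqrt] at h3
  rw [h3] at h2
  exact h2.symm

theorem apply_eq_zero_of_inner_eq_zero {C : H →L[ℂ] H} (hC : C.IsPositive) {z : H}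
    (h : ⟪C z, z⟫ = 0) : C z = 0 := by
  have h0 : (0 : H →L[ℂ] H) ≤ C := (ContinuousLinearMap.nonneg_iff_isPositive C).2 hC
  have h1 : CFC.sqrt C * CFC.sqrt C = C := CFC.sqrt_mul_sqrt_self C h0
  have h2 : IsSelfAdjoint (CFC.sqrt C) := (CFC.sqrt_nonneg C).isSelfAdjoint
  have h3 : CFC.sqrt C z = 0 := by
    have h4 : ⟪CFC.sqrt C z, CFC.sqrt C z⟫ = ⟪(CFC.sqrt C * CFC.sqrt C) z, z⟫ :=
      (h2.isSymmetric _ _).symm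
    rw [← inner_self_eq_zero (𝕜 := ℂ), h4, h1, h]
  rw [← h1, mul_apply_eq_comp, h3, map_zero]

/-! ### Hankel operators with respect to an isometry -/

theorem IsHankel.isSelfAdjoint {A V : H →L[ℂ] H} (hA : IsSelfAdjoint A) (h : IsHankel A V) :
    IsSelfAdjoint (A ∘L V) := by
  rw [ContinuousLinearMap.isSelfAdjoint_iff', ContinuousLinearMap.adjoint_comp, hA.adjoint_eq]
  exact h

theorem IsHankel.apply {A V : H →L[ℂ] H} (h : IsHankel A V) (x : H) :
    ContinuousLinearMap.adjoint V (A x) = A (V x) :=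
  DFunLike.congr_fun h x

theorem isHankel_of_isSelfAdjoint {A V : H →L[ℂ] H} (hA : IsSelfAdjoint A)
    (h : IsSelfAdjoint (A ∘L V)) : IsHankel A V := by
  rw [ContinuousLinearMap.isSelfAdjoint_iff', ContinuousLinearMap.adjoint_comp, hA.adjoint_eq] at h
  exact h

theorem isSymmRestriction_of_isHankel {A V : H →L[ℂ] H} (hA : IsSelfAdjoint A)
    (hinj : Function.Injective A) {N : ℕ∞} (hV : Isometry V) (hN : HasPurePart V N)
    (hAV : IsHankel A V) {T : H →ₗ.[ℂ] H} (hT : T ≤ inv A)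
    (hran : ran T = LinearMap.range (V : H →ₗ[ℂ] H)) : IsSymmRestriction A N T := by
  refine ⟨hT, ?_, ?_, isFormalAdjoint_of_le_inv hA hinj hT, ?_⟩
  · have h : (T.domain : Set H) = Set.range (A ∘L V) := by
      ext x
      simp [mem_domain_of_le_inv hinj hT, hran]
    rw [h]
    exact denseRange_of_isSelfAdjoint (hAV.isSelfAdjoint hA) (hinj.comp hV.injective)
  · rw [isClosed_iff_of_le_inv hinj hT, hran]
    exact isClosed_range_of_isometry hV
  · rw [hasDeficiencyIndices_iff hA hinj hT, hran, hN.dim_eq]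

/-- If `D` is a self-adjoint operator in `J` that is contained in `A⁻¹`, then `D` is onto `J`: for
`y ∈ J` the projection `w` of `A y` to `J` satisfies `D w = y`. -/
theorem mem_graph_of_isSelfAdjoint {A : H →L[ℂ] H} (hA : IsSelfAdjoint A) {J : Submodule ℂ H}
    [CompleteSpace J] {D : J →ₗ.[ℂ] J} (hd : Dense (D.domain : Set J)) (hD : IsSelfAdjoint D)
    (hDA : ∀ x y : J, (x, y) ∈ D.graph → A y = x) (y : J) :
    (J.orthogonalProjectionOnto (A y), y) ∈ D.graph := by
  have h := mem_graph_adjoint hd (x := J.orthogonalProjectionOnto (A y)) (y := y)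
  rw [LinearPMap.isSelfAdjoint_def.1 hD] at h
  refine h.2 fun a b hab => ?_
  rw [Submodule.coe_inner, Submodule.coe_inner, ← hDA a b hab,
    ← Submodule.starProjection_apply, ← Submodule.inner_starProjection_left_eq_right,
    Submodule.starProjection_eq_self_iff.2 b.2]
  exact (hA.isSymmetric _ _).symm

/-- On a subspace `J` carrying a self-adjoint part of `A⁻¹|_{Ran V}` one has `(A V)² = A²`, so that
`J` reduces `A V = √((A V)²)` and `A`, hence also `V*`; as `J ⊆ Ran V`, a pure `V` leaves no room
for it. -/
theorem isSimple_of_isPure {A V : H →L[ℂ] H} (hA : IsSelfAdjoint A)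
    (hinj : Function.Injective A) (hAV : IsHankel A V) (hV : Isometry V) (hpure : IsPure V)
    (hpos : (A ∘L V).IsPositive) {T : H →ₗ.[ℂ] H} (hT : T ≤ inv A)
    (hran : ran T = LinearMap.range (V : H →ₗ[ℂ] H)) : IsSimple T := by
  intro J _ hJ D hd hD hDT
  have hgr : ∀ x y : J, (x, y) ∈ D.graph → (y : H) ∈ ran T ∧ A y = x := by
    intro x y hxy
    obtain ⟨w, rfl, rfl⟩ := (LinearPMap.mem_graph_iff _).1 hxy
    exact (mem_graph_of_le_inv hinj hT).1 (hDT w)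
  have hy : ∀ y ∈ J, (∃ u, V u = y) ∧ A y ∈ J := by
    intro y hyJ
    obtain ⟨h1, h2⟩ := hgr _ _
      (mem_graph_of_isSelfAdjoint hA hd hD (fun x y h => (hgr x y h).2) ⟨y, hyJ⟩)
    rw [hran] at h1
    refine ⟨h1, ?_⟩
    change A y = _ at h2
    rw [h2]
    exact Submodule.coe_mem _
  have hB := hAV.isSelfAdjoint hA
  -- Both `y` and `A y` lie in `Ran V`; writing `A y = V u` gives `A V y = V* A y = u`.
  have hsq : ∀ y ∈ J, (A ∘L V) ((A ∘L V) y) = A (A y) := by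
    intro y hyJ
    obtain ⟨u, hu⟩ := (hy _ (hy y hyJ).2).1
    have h1 : (A ∘L V) y = u := by
      rw [ContinuousLinearMap.comp_apply, ← hAV.apply, ← hu, adjoint_apply_of_isometry hV]
    rw [h1, ← hu]
    rfl
  have hPB : Commute J.starProjection (A ∘L V) := by
    refine commute_of_commute_mul_self hpos (commute_starProjection ?_ fun x hx => ?_)
    · rw [isSelfAdjoint_iff, star_mul, hB.star_eq]
    · rw [mul_apply_eq_comp, hsq x hx]
      exact (hy _ (hy x hx).2).2
  have hPA : Commute J.starProjection A := commute_starProjection hA fun x hx => (hy x hx).2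
  -- `P V* A = P A V = A V P = V* A P = V* P A`, and `A` has dense range.
  have hPV : ∀ x, J.starProjection (ContinuousLinearMap.adjoint V x) =
      ContinuousLinearMap.adjoint V (J.starProjection x) := by
    refine fun x => congrFun ((denseRange_of_isSelfAdjoint hA hinj).equalizer (g := fun x =>
      J.starProjection (ContinuousLinearMap.adjoint V x)) (h := fun x =>
      ContinuousLinearMap.adjoint V (J.starProjection x)) (by fun_prop) (by fun_prop) ?_) x
    funext x
    simp only [Function.comp_apply]
    rw [hAV.apply]
    have h1 := DFunLike.congr_fun hPB.eq x
    have h2 := DFunLike.congr_fun hPA.eq x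
    simp only [mul_apply_eq_comp, ContinuousLinearMap.comp_apply] at h1 h2
    rw [h1, h2, hAV.apply]
  refine hJ ((Submodule.eq_bot_iff _).2 fun x hx => hpure.eq_zero_of_mem (J := J) ?_ hx)
  intro x hx
  obtain ⟨u, rfl⟩ := (hy x hx).1
  refine ⟨u, ?_, rfl⟩
  have h := hPV (V u)
  rw [Submodule.starProjection_eq_self_iff.2 hx, adjoint_apply_of_isometry hV] at h
  exact Submodule.starProjection_eq_self_iff.1 h

/-- If `A V ≥ 0`, then `V` squares to the identity on its unitary part. With `U` and `C ≥ 0` the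
compressions of `V` and of `A V` to that part, the Hankel relation reads `C U = U* C`; hence
`U C = C U*`, so that `U` commutes with `C²` and with `C`, and `C (U - U*) = 0`. -/
theorem map_map_eq_of_mem_unitaryPart {A V : H →L[ℂ] H} (hinj : Function.Injective A) (hAV : IsHankel A V) (hV : Isometry V)
    (hpos : (A ∘L V).IsPositive) {y : H} (hy : y ∈ unitaryPart V) : V (V y) = y := by
  have : CompleteSpace (unitaryPart V) := (isClosed_unitaryPart hV).completeSpace_coe
  set p : H →L[ℂ] H := (unitaryPart V).starProjection with hpdef
  set b : H →L[ℂ] H := A ∘L V with hbdef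
  have hpself : ∀ x ∈ unitaryPart V, p x = x := fun x hx =>
    Submodule.starProjection_eq_self_iff.2 hx
  have hpmem : ∀ x, p x ∈ unitaryPart V := fun x => Submodule.starProjection_apply_mem _ _
  have hp : star p = p := isSelfAdjoint_starProjection _
  have hpp : p * p = p := by
    ext x
    exact hpself _ (hpmem x)
  have hadj : ∀ x ∈ unitaryPart V, star V x ∈ unitaryPart V ∧ V (star V x) = x := by
    intro x hx
    obtain ⟨w, hw, rfl⟩ := exists_map_eq_of_mem_unitaryPart hV hx
    rw [ContinuousLinearMap.star_eq_adjoint, adjoint_apply_of_isometry hV]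
    exact ⟨hw, rfl⟩
  have hvp : p * V * p = V * p := by
    ext x
    exact hpself _ (map_mem_unitaryPart (hpmem x))
  have hvp' : p * star V * p = star V * p := by
    ext x
    exact hpself _ (hadj _ (hpmem x)).1
  -- The subspace reduces `V`: it is invariant under both `V` and `V*`.
  have hcomm : p * V = V * p := by
    have h := congrArg star hvp'
    simp only [star_mul, hp, star_star] at h
    rw [← h, ← mul_assoc, hvp]
  have hcomm' : p * star V = star V * p := by
    have h := congrArg star hcomm
    simp only [star_mul, hp] at h
    exact h.symm
  have hco : V * star V * p = p := by
    ext x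
    exact (hadj _ (hpmem x)).2
  have hbV : star V * b = b * V := by
    ext x
    exact hAV.apply (V x)
  set c : H →L[ℂ] H := p * b * p with hcdef
  have hc : c.IsPositive := hpos.conj_starProjection _
  have hpc : p * c = c := by rw [hcdef, ← mul_assoc, ← mul_assoc, hpp]
  have hcp : c * p = c := by rw [hcdef, mul_assoc, hpp]
  have h1 : c * V = star V * c := by
    calc c * V = p * (b * V) * p := by simp only [hcdef, mul_assoc, hcomm]
      _ = star V * c := by
        rw [← hbV, ← mul_assoc, hcomm', hcdef]
        simp only [mul_assoc]
  have h2 : V * c = c * star V := by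
    calc V * c = V * (c * (V * star V * p)) := by rw [hco, hcp]
      _ = V * ((c * V) * (star V * p)) := by simp only [mul_assoc]
      _ = (V * star V * p) * (c * star V * p) := by
        rw [h1, ← hpc]
        simp only [mul_assoc]
        rw [← mul_assoc p p, hpp]
      _ = c * star V := by
        rw [hco, mul_assoc c, ← hcomm', ← mul_assoc c, hcp, ← mul_assoc, hpc]
  have h3 : Commute V (c * c) := by
    calc V * (c * c) = (V * c) * c := (mul_assoc _ _ _).symm
      _ = c * (star V * c) := by rw [h2, mul_assoc]
      _ = c * c * V := by rw [← h1, mul_assoc c c V]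
  have h4 : c * V = c * star V := by
    rw [← h2]
    exact (commute_of_commute_mul_self hc h3).eq.symm
  set z := V y - star V y with hz
  have hzU : z ∈ unitaryPart V := sub_mem (map_mem_unitaryPart hy) (hadj y hy).1
  have hcz : c z = 0 := by
    rw [hz, map_sub, sub_eq_zero]
    exact DFunLike.congr_fun h4 y
  have hbz : b z = 0 := by
    apply apply_eq_zero_of_inner_eq_zero hpos
    have h5 : ⟪c z, z⟫ = ⟪b z, z⟫ := by
      rw [hcdef, mul_apply_eq_comp, mul_apply_eq_comp, hpself z hzU, hpdef,
        Submodule.inner_starProjection_left_eq_right, ← hpdef, hpself z hzU]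
    rw [← h5, hcz, inner_zero_left]
  have hz0 : z = 0 := hinj.comp hV.injective (hbz.trans (map_zero b).symm)
  rw [sub_eq_zero.1 hz0]
  exact (hadj y hy).2

/-- If `A V ≥ 0`, then `A` leaves the unitary part of `V` invariant. -/
theorem map_mem_unitaryPart_of_isHankel {A V : H →L[ℂ] H} (hinj : Function.Injective A) (hAV : IsHankel A V) (hV : Isometry V)
    (hpos : (A ∘L V).IsPositive) {y : H} (hy : y ∈ unitaryPart V) : A y ∈ unitaryPart V := by
  have h1 : ContinuousLinearMap.adjoint V (ContinuousLinearMap.adjoint V (A y)) = A y := by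
    rw [hAV.apply, hAV.apply, map_map_eq_of_mem_unitaryPart hinj hAV hV hpos hy]
  -- `V²` is an isometry, so `(V²)* a = a` gives `‖V² a - a‖² = 2‖a‖² - 2 Re ⟪V² a, a⟫ = 0`.
  have h2 : V (V (A y)) = A y := by
    have h4 : ⟪A y, V (V (A y))⟫ = ⟪A y, A y⟫ := by
      rw [← ContinuousLinearMap.adjoint_inner_left, ← ContinuousLinearMap.adjoint_inner_left, h1]
    have h5 : ⟪V (V (A y)), A y⟫ = ⟪A y, A y⟫ := by
      rw [← ContinuousLinearMap.adjoint_inner_right, ← ContinuousLinearMap.adjoint_inner_right, h1]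
    rw [← sub_eq_zero, ← inner_self_eq_zero (𝕜 := ℂ), inner_sub_sub_self,
      inner_map_map_of_isometry hV, inner_map_map_of_isometry hV, h4, h5]
    simp
  have h3 : ∀ n : ℕ, (V ^ n) ((V ^ n) (A y)) = A y := by
    intro n
    induction n with
    | zero => rfl
    | succ n ih =>
      calc (V ^ (n + 1)) ((V ^ (n + 1)) (A y)) = (V ^ n * V * (V * V ^ n)) (A y) := by
            rw [← pow_succ, ← pow_succ', mul_apply_eq_comp]
        _ = (V ^ n * V ^ n * (V * V)) (A y) := by
            rw [← pow_two V, ← pow_succ, ← pow_succ', ← pow_add, ← pow_add, ← pow_add]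
            congr 2
            ring
        _ = A y := by
            rw [mul_apply_eq_comp, mul_apply_eq_comp V V, h2]
            exact ih
  exact mem_unitaryPart.2 fun n => ⟨_, h3 n⟩

/-- The unitary part of `V` carries the self-adjoint operator `(A|_{⋂ Ran Vⁿ})⁻¹`, so that it has
to vanish if `A⁻¹|_{Ran V}` is simple. -/
theorem isPure_of_isSimple {A V : H →L[ℂ] H} (hA : IsSelfAdjoint A)
    (hinj : Function.Injective A) (hAV : IsHankel A V) (hV : Isometry V)
    (hpos : (A ∘L V).IsPositive) {T : H →ₗ.[ℂ] H} (hT : T ≤ inv A)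
    (hran : ran T = LinearMap.range (V : H →ₗ[ℂ] H)) (hsimple : IsSimple T) : IsPure V := by
  have : CompleteSpace (unitaryPart V) := (isClosed_unitaryPart hV).completeSpace_coe
  have hU : unitaryPart V = ⊥ := by
    by_contra hne
    let C : unitaryPart V →L[ℂ] unitaryPart V := (A ∘L (unitaryPart V).subtypeL).codRestrict _
      fun x => map_mem_unitaryPart_of_isHankel hinj hAV hV hpos x.2
    have hCA : ∀ x, (C x : H) = A x := fun x => rfl
    have hC : IsSelfAdjoint C := by
      rw [ContinuousLinearMap.isSelfAdjoint_iff_isSymmetric]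
      intro x y
      exact hA.isSymmetric (x : H) y
    have hCinj : Function.Injective C := fun x y hxy =>
      Subtype.ext (hinj (congrArg Subtype.val hxy))
    refine hsimple (unitaryPart V) hne (inv C) (dense_domain_inv hC hCinj)
      (isSelfAdjoint_inv hC hCinj) fun x => ?_
    have hx := (mem_graph_inv hCinj).1 ((inv C).mem_graph x)
    refine (mem_graph_of_le_inv hinj hT).2 ⟨?_, ?_⟩
    · rw [hran]
      obtain ⟨w, hw⟩ := mem_unitaryPart.1 ((inv C) x).2 1
      exact ⟨w, by simpa using hw⟩
    · rw [← hCA, hx]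
  refine isPure_of_forall_mem_range_pow hV fun x hx => ?_
  rw [← mem_unitaryPart, hU] at hx
  exact (Submodule.mem_bot ℂ).1 hx

/-! ### Polar decompositions -/

/-- The polar decomposition of `T`, whose graph is `{(A y, y) : y ∈ Ran T}`: with `P` the projection
to `Ran T`, `T* T` is the inverse of `A P A`, so that `|T|⁻¹ = √(A P A)`, and `V` is the isometry
in the polar decomposition `P A = V √(A P A)` of a bounded operator. -/
theorem exists_isPolarDecomposition {A : H →L[ℂ] H} (hA : IsSelfAdjoint A)
    (hinj : Function.Injective A) {T : H →ₗ.[ℂ] H} (hT : T ≤ inv A)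
    (hd : Dense (T.domain : Set H)) (hcl : T.IsClosed) :
    ∃ (V : H →L[ℂ] H) (S : H →ₗ.[ℂ] H), IsPolarDecomposition T V S := by
  rw [isClosed_iff_of_le_inv hinj hT] at hcl
  have : CompleteSpace (ran T) := hcl.completeSpace_coe
  set P : H →L[ℂ] H := (ran T).starProjection with hP
  have hPself : ∀ x ∈ ran T, P x = x := fun x hx => Submodule.starProjection_eq_self_iff.2 hx
  have hPmem : ∀ x, P x ∈ ran T := fun x => Submodule.starProjection_apply_mem _ _
  have hPsymm : ∀ x y, ⟪P x, y⟫ = ⟪x, P y⟫ := fun x y =>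
    Submodule.inner_starProjection_left_eq_right _ x y
  have hAsymm : ∀ x y, ⟪A x, y⟫ = ⟪x, A y⟫ := hA.isSymmetric
  have hR : (A ∘L P ∘L A).IsPositive := by
    have h := (ContinuousLinearMap.IsPositive.of_isStarProjection
      (isStarProjection_starProjection (U := ran T))).conj_adjoint A
    rwa [hA.adjoint_eq] at h
  have hR0 : (0 : H →L[ℂ] H) ≤ A ∘L P ∘L A := (ContinuousLinearMap.nonneg_iff_isPositive _).2 hR
  set B : H →L[ℂ] H := CFC.sqrt (A ∘L P ∘L A) with hBdef
  have hBpos : B.IsPositive := (ContinuousLinearMap.nonneg_iff_isPositive B).1 (CFC.sqrt_nonneg _)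
  have hB : IsSelfAdjoint B := hBpos.isSelfAdjoint
  have hBB : ∀ x, B (B x) = A (P (A x)) := DFunLike.congr_fun (CFC.sqrt_mul_sqrt_self _ hR0)
  have hnorm : ∀ x, ‖P (A x)‖ = ‖B x‖ := by
    intro x
    have h : ⟪P (A x), P (A x)⟫ = ⟪B x, B x⟫ := by
      calc ⟪P (A x), P (A x)⟫ = ⟪A x, P (A x)⟫ := by rw [hPsymm, hPself _ (hPmem _)]
        _ = ⟪x, B (B x)⟫ := by rw [hAsymm, hBB]
        _ = ⟪B x, B x⟫ := (hB.isSymmetric _ _).symm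
    rw [inner_self_eq_norm_sq_to_K, inner_self_eq_norm_sq_to_K] at h
    exact (sq_eq_sq₀ (norm_nonneg _) (norm_nonneg _)).1 (by exact_mod_cast h)
  have hPA0 : ∀ x, P (A x) = 0 → x = 0 := by
    intro x hx
    refine hd.eq_zero_of_inner_right ℂ fun v hv => ?_
    obtain ⟨m, hm, hmv⟩ := (mem_domain_of_le_inv hinj hT).1 hv
    rw [← hmv, hAsymm, ← hPself m hm, hPsymm, hx, inner_zero_right]
  have hBinj : Function.Injective B := by
    rw [injective_iff_map_eq_zero]
    intro x hx
    apply hPA0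
    rw [← norm_eq_zero, hnorm, hx, norm_zero]
  have hBd : DenseRange B := denseRange_of_isSelfAdjoint hB hBinj
  let V : H →L[ℂ] H := ((P ∘L A : H →L[ℂ] H) : H →ₗ[ℂ] H).extendOfNorm (B : H →ₗ[ℂ] H)
  have hVB : ∀ x, V (B x) = P (A x) := fun x =>
    LinearMap.extendOfNorm_eq (f := ((P ∘L A : H →L[ℂ] H) : H →ₗ[ℂ] H)) (e := (B : H →ₗ[ℂ] H))
      hBd ⟨1, fun x => by simpa using (hnorm x).le⟩ x
  have hVnorm : ∀ x, ‖V x‖ = ‖x‖ := by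
    refine fun x => congrFun (hBd.equalizer (g := fun x => ‖V x‖) (h := fun x => ‖x‖)
      (by fun_prop) (by fun_prop) ?_) x
    funext x
    simp only [Function.comp_apply]
    rw [hVB, hnorm]
  have hVi : Isometry V := (AddMonoidHomClass.isometry_iff_norm V).2 hVnorm
  have hAV : ∀ x, A (V x) = B x := by
    refine fun x => congrFun (hBd.equalizer (g := fun x => A (V x)) (h := fun x => B x)
      (by fun_prop) (by fun_prop) ?_) x
    funext x
    simp only [Function.comp_apply]
    rw [hVB, hBB]
  -- `Ran V` is closed and contains `Ran P A`, whose orthogonal complement is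
  -- `Ker A P = (Ran T)ᗮ`.
  have hVran : ∀ y, y ∈ ran T ↔ ∃ x, V x = y := by
    intro y
    constructor
    · intro hy
      have h : y ∈ (LinearMap.range (V : H →ₗ[ℂ] H))ᗮᗮ := by
        rw [Submodule.mem_orthogonal]
        intro u hu
        have hu0 : P u = 0 := by
          apply hinj
          rw [map_zero]
          refine ext_inner_left ℂ fun x => ?_
          rw [inner_zero_right, ← hAsymm, ← hPsymm, ← hVB]
          exact (Submodule.mem_orthogonal _ _).1 hu _ ⟨_, rfl⟩
        rw [← hPself y hy, ← hPsymm, hu0, inner_zero_left]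
      rw [range_orthogonal_orthogonal hVi] at h
      exact h
    · rintro ⟨x, rfl⟩
      refine hBd.induction_on (p := fun x => V x ∈ ran T) x (hcl.preimage V.continuous) ?_
      intro z
      rw [hVB]
      exact hPmem _
  have hker : ker T = ⊥ := ker_eq_bot_of_le_inv hinj hT
  refine ⟨V, inv B, ⟨isSelfAdjoint_inv hB hBinj, fun x => ?_, fun x y => ?_⟩, ?_,
    fun x _ => hVnorm x, fun x hx => ?_⟩
  · have hx := (mem_graph_inv hBinj).1 ((inv B).mem_graph x)
    have h := hBpos.re_inner_nonneg_right ((inv B) x)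
    rw [hx] at h
    exact h
  · simp only [mem_graph_inv hBinj, mem_graph_adjoint hd, mem_graph_of_le_inv hinj hT]
    -- The condition on the left says that `(z, y)` is in the graph of `T*`.
    have key : ∀ z ∈ ran T, (∀ a b, (b ∈ ran T ∧ A b = a) → ⟪b, z⟫ = ⟪a, y⟫) ↔ P (A y) = z := by
      intro z hz
      constructor
      · intro h
        refine ext_inner_left ℂ fun v => ?_
        have h1 := h _ _ ⟨hPmem v, rfl⟩
        rw [hAsymm, hPsymm, hPsymm, hPself z hz] at h1
        exact h1.symm
      · rintro rfl a b ⟨hb, rfl⟩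
        rw [hAsymm, ← hPsymm, hPself b hb]
    constructor
    · rintro ⟨z, rfl, rfl⟩
      exact ⟨P (A y), ⟨hPmem _, (hBB y).symm⟩, (key _ (hPmem _)).2 rfl⟩
    · rintro ⟨z, ⟨hz, rfl⟩, h⟩
      refine ⟨B y, ?_, rfl⟩
      rw [hBB, (key z hz).1 h]
  · apply LinearPMap.eq_of_eq_graph
    ext ⟨x, y⟩
    rw [compPMap_mem_graph, mem_graph_of_le_inv hinj hT, hVran]
    simp only [mem_graph_inv hBinj]
    constructor
    · rintro ⟨⟨z, rfl⟩, rfl⟩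
      exact ⟨z, (hAV z).symm, rfl⟩
    · rintro ⟨z, rfl, rfl⟩
      exact ⟨⟨z, rfl⟩, hAV z⟩
  · rw [hker, Submodule.mem_bot] at hx
    rw [hx, map_zero]

/-- In a polar decomposition `T = V |T|`, the operator `|T|` is a self-adjoint bijection and
`A V` is its inverse; self-adjointness of `A V` is the Hankel property. -/
theorem IsPolarDecomposition.isHankel {A : H →L[ℂ] H} (hA : IsSelfAdjoint A)
    (hinj : Function.Injective A) {T : H →ₗ.[ℂ] H} (hT : T ≤ inv A) (hcl : T.IsClosed)
    {V : H →L[ℂ] H} {S : H →ₗ.[ℂ] H} (h : IsPolarDecomposition T V S) :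
    Isometry V ∧ IsHankel A V ∧ LinearMap.range (V : H →ₗ[ℂ] H) = ran T ∧
      (A ∘L V).IsPositive := by
  rw [isClosed_iff_of_le_inv hinj hT] at hcl
  have hV : Isometry V := by
    refine (AddMonoidHomClass.isometry_iff_norm V).2 fun x => h.norm_eq x ?_
    rw [ker_eq_bot_of_le_inv hinj hT, Submodule.bot_orthogonal_eq_top]
    trivial
  have hS := h.abs.selfAdjoint
  have hS' := LinearPMap.isSelfAdjoint_def.1 hS
  have hSd : Dense (S.domain : Set H) := hS.dense_domain
  have hgr : ∀ x y, (x, y) ∈ T.graph ↔ ∃ z, (x, z) ∈ S.graph ∧ V z = y := by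
    intro x y
    rw [← compPMap_mem_graph, ← h.eq_comp]
  have hSA : ∀ x z, (x, z) ∈ S.graph → A (V z) = x := fun x z hz =>
    ((mem_graph_of_le_inv hinj hT).1 ((hgr x (V z)).2 ⟨z, hz, rfl⟩)).2
  -- `Ran S` is the preimage of the closed subspace `Ran T` under the isometry `V`, and it is
  -- dense because `S` is self-adjoint and injective.
  have hranS : ∀ z, z ∈ ran S ↔ V z ∈ ran T := by
    intro z
    simp only [mem_ran, hgr]
    constructor
    · rintro ⟨x, hx⟩
      exact ⟨x, z, hx, rfl⟩
    · rintro ⟨x, w, hw, hwz⟩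
      exact ⟨x, hV.injective hwz ▸ hw⟩
  have hScl : IsClosed (ran S : Set H) := by
    have h1 : (ran S : Set H) = V ⁻¹' (ran T : Set H) := by
      ext z
      exact hranS z
    rw [h1]
    exact hcl.preimage V.continuous
  have hStop : ran S = ⊤ := by
    have : CompleteSpace (ran S) := hScl.completeSpace_coe
    rw [← Submodule.orthogonal_eq_bot_iff, Submodule.eq_bot_iff]
    intro u hu
    have h1 : (u, (0 : H)) ∈ S.graph := by
      rw [← hS', mem_graph_adjoint hSd]
      intro a b hab
      rw [inner_zero_right]
      exact (Submodule.mem_orthogonal _ _).1 hu _ (mem_ran.2 ⟨a, hab⟩)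
    simpa using (hSA _ _ h1).symm
  have hSall : ∀ z, (A (V z), z) ∈ S.graph := by
    intro z
    obtain ⟨x, hx⟩ := mem_ran.1 (hStop ▸ Submodule.mem_top : z ∈ ran S)
    rwa [hSA x z hx]
  have hsa : IsSelfAdjoint (A ∘L V) := by
    rw [ContinuousLinearMap.isSelfAdjoint_iff_isSymmetric]
    intro x y
    have h1 := hSall y
    rw [← hS', mem_graph_adjoint hSd] at h1
    exact (h1 _ _ (hSall x)).symm
  refine ⟨hV, isHankel_of_isSelfAdjoint hA hsa, ?_, ?_⟩
  · ext y
    constructor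
    · rintro ⟨z, rfl⟩
      exact (hranS z).1 (hStop ▸ Submodule.mem_top)
    · intro hy
      obtain ⟨x, hx⟩ := mem_ran.1 hy
      obtain ⟨z, -, hz⟩ := (hgr x y).1 hx
      exact ⟨z, hz⟩
  · refine ContinuousLinearMap.isPositive_def'.2 ⟨hsa, fun z => ?_⟩
    obtain ⟨x, hx, hxz⟩ := (LinearPMap.mem_graph_iff _).1 (hSall z)
    simp only at hx hxz
    have h1 := h.abs.nonneg x
    rw [hx, hxz, ← inner_conj_symm, Complex.conj_re] at h1
    exact h1

end

end HankelSym

theorem theoremD {H : Type*} [NormedAddCommGroup H] [InnerProductSpace ℂ H] [CompleteSpace H]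
    [TopologicalSpace.SeparableSpace H]
    (A : H →L[ℂ] H) (hA : IsSelfAdjoint A) (hinj : Function.Injective A) (hninv : ¬ IsUnit A)
    (N : ℕ∞) :
    -- the equivalence, for isometries and restrictions with a common range `M`
    (∀ M : Submodule ℂ H,
      (∃ V : H →L[ℂ] H, Isometry V ∧ HankelSym.HasPurePart V N ∧ HankelSym.IsHankel A V ∧
          LinearMap.range (V : H →ₗ[ℂ] H) = M) ↔
        ∃ T : H →ₗ.[ℂ] H, HankelSym.IsSymmRestriction A N T ∧ HankelSym.ran T = M) ∧
    -- from isometries to restrictions: `V ↦ A⁻¹` restricted to `Ran AV`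
    (∀ V : H →L[ℂ] H, Isometry V → HankelSym.HasPurePart V N → HankelSym.IsHankel A V →
      HankelSym.IsSymmRestriction A N
          ((HankelSym.inv A).domRestrict (LinearMap.range ((A ∘L V : H →L[ℂ] H) : H →ₗ[ℂ] H))) ∧
        HankelSym.ran
            ((HankelSym.inv A).domRestrict (LinearMap.range ((A ∘L V : H →L[ℂ] H) : H →ₗ[ℂ] H))) =
          LinearMap.range (V : H →ₗ[ℂ] H) ∧
        (HankelSym.IsPure V → HankelSym.IsStrictlyPos (A ∘L V) →
          HankelSym.IsSimple
            ((HankelSym.inv A).domRestrict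
              (LinearMap.range ((A ∘L V : H →L[ℂ] H) : H →ₗ[ℂ] H))))) ∧
    -- from restrictions to isometries: the partial isometry of the polar decomposition
    (∀ T : H →ₗ.[ℂ] H, HankelSym.IsSymmRestriction A N T →
      (∃ (V : H →L[ℂ] H) (S : H →ₗ.[ℂ] H), HankelSym.IsPolarDecomposition T V S) ∧
      ∀ (V : H →L[ℂ] H) (S : H →ₗ.[ℂ] H), HankelSym.IsPolarDecomposition T V S →
        Isometry V ∧ HankelSym.HasPurePart V N ∧ HankelSym.IsHankel A V ∧
          LinearMap.range (V : H →ₗ[ℂ] H) = HankelSym.ran T ∧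
          (HankelSym.IsSimple T → 0 < N → HankelSym.IsPure V) ∧
          (HankelSym.IsPure V → HankelSym.IsStrictlyPos (A ∘L V) → HankelSym.IsSimple T)) := by
  have h2 : ∀ V : H →L[ℂ] H, Isometry V → HankelSym.HasPurePart V N → HankelSym.IsHankel A V →
      HankelSym.IsSymmRestriction A N
        ((HankelSym.inv A).domRestrict (LinearMap.range ((A ∘L V : H →L[ℂ] H) : H →ₗ[ℂ] H))) :=
    fun V hV hN hAV => HankelSym.isSymmRestriction_of_isHankel hA hinj hV hN hAV
      LinearPMap.domRestrict_le (HankelSym.ran_domRestrict_inv hinj)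
  have h3 : ∀ T : H →ₗ.[ℂ] H, HankelSym.IsSymmRestriction A N T →
      ∃ (V : H →L[ℂ] H) (S : H →ₗ.[ℂ] H), HankelSym.IsPolarDecomposition T V S :=
    fun T hT => HankelSym.exists_isPolarDecomposition hA hinj hT.le_inv hT.dense hT.closed
  have h4 : ∀ (T : H →ₗ.[ℂ] H) (V : H →L[ℂ] H), HankelSym.IsSymmRestriction A N T →
      Isometry V → LinearMap.range (V : H →ₗ[ℂ] H) = HankelSym.ran T →
      HankelSym.HasPurePart V N := by
    intro T V hT hV hran
    have h := HankelSym.hasPurePart_of_isometry hV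
    rwa [hran, (HankelSym.hasDeficiencyIndices_iff hA hinj hT.le_inv).1 hT.deficiency] at h
  refine ⟨fun M => ⟨?_, ?_⟩, fun V hV hN hAV => ⟨h2 V hV hN hAV,
    HankelSym.ran_domRestrict_inv hinj, fun hpure hpos => ?_⟩,
    fun T hT => ⟨h3 T hT, fun V S hVS => ?_⟩⟩
  · rintro ⟨V, hV, hN, hAV, rfl⟩
    exact ⟨_, h2 V hV hN hAV, HankelSym.ran_domRestrict_inv hinj⟩
  · rintro ⟨T, hT, rfl⟩
    obtain ⟨V, S, hVS⟩ := h3 T hT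
    obtain ⟨hV, hAV, hran, -⟩ := hVS.isHankel hA hinj hT.le_inv hT.closed
    exact ⟨V, hV, h4 T V hT hV hran, hAV, hran⟩
  · exact HankelSym.isSimple_of_isPure hA hinj hAV hV hpure hpos.1 LinearPMap.domRestrict_le
      (HankelSym.ran_domRestrict_inv hinj)
  · obtain ⟨hV, hAV, hran, hpos⟩ := hVS.isHankel hA hinj hT.le_inv hT.closed
    exact ⟨hV, h4 T V hT hV hran, hAV, hran,
      fun hs _ => HankelSym.isPure_of_isSimple hA hinj hAV hV hpos hT.le_inv hran.symm hs,
      fun hpure hp => HankelSym.isSimple_of_isPure hA hinj hAV hV hpure hp.1 hT.le_inv hran.symm⟩
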